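/- Let $N\ge 1$ and let $P(z)=\alpha_0+\alpha_1 z+\dots+\alpha_N z^N$ be a polynomial with complex coefficients such that $\alpha_0\alpha_N\neq 0$. Let $z_1,\dots,z_N\in\mathbb C$ be the zeros of $P$, repeated according to multiplicity, let $\nu_P=\frac1N\sum_{j=1}^N\delta_{z_j}$ be the normalized zero-counting measure of $P$, and put $$L(P)=\frac{|\alpha_0|+|\alpha_1|+\dots+|\alpha_N|}{\sqrt{|\alpha_0|\,|\alpha_N|}}.$$ Let $\mu$ be the uniform probability measure on the unit circle $\{z\in\mathbb C:|z|=1\}$. For probability measures $\nu,\mu$ on $\mathbb C$ let $$d_{\rm BL}(\nu,\mu)=\sup\Big\{\Big|\int f\,d\nu-\int f\,d\mu\Big| \;:\; f:\mathbb C\to\mathbb R,\ \|f\|_{\rm Lip}+\|f\|_\infty\le 1\Big\}$$ be the bounded Lipschitz metric, where $\|f\|_{\rm Lip}=\sup_{z\ne w}|f(z)-f(w)|/|z-w|$ and $\|f\|_\infty=\sup_z|f(z)|$. Then $$d_{\rm BL}(\nu_P,\mu)\le 32\left(\frac{\log L(P)}{N}\right)^{1/4}.$$ -/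

import Mathlib

open MeasureTheory
open scoped ENNReal

/-- The ratio `L(P) = (|α₀| + |α₁| + ⋯ + |α_N|) / √(|α₀| |α_N|)` of a polynomial
`P = α₀ + α₁ z + ⋯ + α_N z^N` of degree `N`. -/
noncomputable def coeffRatio (P : Polynomial ℂ) : ℝ :=
  (∑ i ∈ Finset.range (P.natDegree + 1), ‖P.coeff i‖) /
    Real.sqrt (‖P.coeff 0‖ * ‖P.coeff P.natDegree‖)

/-- The empirical measure `ν_P = N⁻¹ ∑ δ_z` of the zeros `z` of `P`, taken with multiplicity,
where `N` is the degree of `P`. It is a probability measure as soon as `1 ≤ N`. -/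
noncomputable def zeroMeasure (P : Polynomial ℂ) : Measure ℂ :=
  (P.natDegree : ℝ≥0∞)⁻¹ • (P.roots.map fun z => Measure.dirac z).sum

/-- The uniform probability measure on the unit circle, as a measure on `ℂ`: the image of the
normalized Lebesgue measure on `(0, 2π]` under `t ↦ exp (i t)`. -/
noncomputable def unitCircleMeasure : Measure ℂ :=
  (ENNReal.ofReal (2 * Real.pi))⁻¹ •
    (volume.restrict (Set.Ioc 0 (2 * Real.pi))).map
      (fun t : ℝ => Complex.exp (t * Complex.I))

/-- The Lipschitz seminorm: the supremum of `|f z - f w| / |z - w|` over `z ≠ w`. -/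
noncomputable def lipSeminorm (f : ℂ → ℝ) : ℝ≥0∞ :=
  ⨆ (z : ℂ) (w : ℂ) (_ : z ≠ w), edist (f z) (f w) / edist z w

/-- The supremum norm. -/
noncomputable def supNorm (f : ℂ → ℝ) : ℝ≥0∞ :=
  ⨆ z : ℂ, ‖f z‖ₑ

/-- The bounded Lipschitz norm `‖f‖_BL = ‖f‖_Lip + ‖f‖_∞`, infinite when `f` is unbounded or
not Lipschitz. -/
noncomputable def blNorm (f : ℂ → ℝ) : ℝ≥0∞ :=
  lipSeminorm f + supNorm f

/-- The bounded Lipschitz distance of two probability measures on `ℂ`: the supremum of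
`|∫ f dν - ∫ f dμ|` over all `f : ℂ → ℝ` with `‖f‖_BL ≤ 1`. It is taken in `[0, ∞]`, so that the
supremum needs no convention. -/
noncomputable def blDist (ν μ : Measure ℂ) : ℝ≥0∞ :=
  ⨆ (f : ℂ → ℝ) (_ : blNorm f ≤ 1), ENNReal.ofReal |(∫ z, f z ∂ν) - ∫ z, f z ∂μ|

theorem integral_unitCircleMeasure {E : Type*} [NormedAddCommGroup E] [NormedSpace ℝ E]
    {f : ℂ → E} (hf : Continuous f) :
    ∫ z, f z ∂unitCircleMeasure =
      (2 * Real.pi)⁻¹ • ∫ t in (0 : ℝ)..2 * Real.pi, f (Complex.exp (t * Complex.I)) := by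
  rw [unitCircleMeasure, integral_smul_measure, ENNReal.toReal_inv,
    ENNReal.toReal_ofReal Real.two_pi_pos.le, integral_map (by fun_prop)
      hf.aestronglyMeasurable, intervalIntegral.integral_of_le Real.two_pi_pos.le]

instance isProbabilityMeasure_unitCircleMeasure : IsProbabilityMeasure unitCircleMeasure := by
  refine ⟨?_⟩
  rw [unitCircleMeasure, Measure.smul_apply, Measure.map_apply (by fun_prop) MeasurableSet.univ]
  simp only [Set.preimage_univ, Measure.restrict_apply_univ, Real.volume_Ioc, sub_zero,
    smul_eq_mul]
  exact ENNReal.inv_mul_cancel (by simpa using Real.pi_pos) ENNReal.ofReal_ne_top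

theorem ae_norm_eq_one_unitCircleMeasure : ∀ᵐ z ∂unitCircleMeasure, ‖z‖ = 1 := by
  rw [unitCircleMeasure]
  refine Measure.ae_smul_measure ?_ _
  rw [ae_map_iff (by fun_prop) (measurableSet_eq_fun (by fun_prop) (by fun_prop))]
  exact Filter.Eventually.of_forall fun t => Complex.norm_exp_ofReal_mul_I t

theorem ContinuousOn.integrable_unitCircleMeasure {E : Type*} [NormedAddCommGroup E]
    {f : ℂ → E} (hf : ContinuousOn f (Metric.sphere 0 1))
    (hm : AEStronglyMeasurable f unitCircleMeasure) : Integrable f unitCircleMeasure := by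
  obtain ⟨C, hC⟩ := (isCompact_sphere (0 : ℂ) 1).exists_bound_of_continuousOn hf
  refine Integrable.of_bound hm C ?_
  filter_upwards [ae_norm_eq_one_unitCircleMeasure] with z hz
  exact hC z (by simpa using hz)

theorem Continuous.integrable_unitCircleMeasure {E : Type*} [NormedAddCommGroup E]
    {f : ℂ → E} (hf : Continuous f) : Integrable f unitCircleMeasure :=
  hf.continuousOn.integrable_unitCircleMeasure hf.aestronglyMeasurable

theorem integral_pow_mul_conj_pow_unitCircleMeasure (i j : ℕ) :
    ∫ z, z ^ i * (starRingEnd ℂ z) ^ j ∂unitCircleMeasure = if i = j then 1 else 0 := by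
  have hexp : ∀ t : ℝ, Complex.exp (t * Complex.I) ^ i *
      (starRingEnd ℂ (Complex.exp (t * Complex.I))) ^ j =
      Complex.exp ((((i : ℂ) - j) * Complex.I) * t) := by
    intro t
    rw [← Complex.exp_conj, ← Complex.exp_nat_mul, ← Complex.exp_nat_mul, ← Complex.exp_add]
    simp only [map_mul, Complex.conj_ofReal, Complex.conj_I]
    ring_nf
  rw [integral_unitCircleMeasure (by fun_prop)]
  simp_rw [hexp]
  split_ifs with h
  · subst h
    have : (Real.pi : ℂ) ≠ 0 := Complex.ofReal_ne_zero.2 Real.pi_ne_zero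
    simp
    field_simp
  · have hc : ((i : ℂ) - j) * Complex.I ≠ 0 :=
      mul_ne_zero (sub_ne_zero.2 (by exact_mod_cast h)) Complex.I_ne_zero
    rw [integral_exp_mul_complex hc]
    have : Complex.exp (((i : ℂ) - j) * Complex.I * ((2 * Real.pi : ℝ) : ℂ)) = 1 := by
      rw [Complex.exp_eq_one_iff]
      exact ⟨(i : ℤ) - j, by push_cast; ring⟩
    rw [this]
    simp

theorem integral_norm_sum_sq_unitCircleMeasure (n : ℕ) (c : ℕ → ℂ) {w : ℂ} (hw : ‖w‖ = 1) :
    ∫ z, ‖∑ j ∈ Finset.range n, c j * (z * w) ^ j‖ ^ 2 ∂unitCircleMeasure =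
      ∑ j ∈ Finset.range n, ‖c j‖ ^ 2 := by
  have key : ∫ z, ((‖∑ j ∈ Finset.range n, c j * (z * w) ^ j‖ ^ 2 : ℝ) : ℂ) ∂unitCircleMeasure =
      ((∑ j ∈ Finset.range n, ‖c j‖ ^ 2 : ℝ) : ℂ) := by
    have : ∀ z : ℂ, ((‖∑ j ∈ Finset.range n, c j * (z * w) ^ j‖ ^ 2 : ℝ) : ℂ) =
        ∑ i ∈ Finset.range n, ∑ j ∈ Finset.range n,
          (c i * starRingEnd ℂ (c j) * w ^ i * (starRingEnd ℂ w) ^ j) *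
            (z ^ i * (starRingEnd ℂ z) ^ j) := by
      intro z
      rw [Complex.ofReal_pow, ← Complex.mul_conj', map_sum, Finset.sum_mul_sum]
      refine Finset.sum_congr rfl fun i _ => Finset.sum_congr rfl fun j _ => ?_
      simp only [map_mul, map_pow]
      ring
    simp_rw [this]
    rw [integral_finsetSum _ fun i _ => Continuous.integrable_unitCircleMeasure (by fun_prop)]
    push_cast
    refine Finset.sum_congr rfl fun i hi => ?_
    rw [integral_finsetSum _ fun j _ => Continuous.integrable_unitCircleMeasure (by fun_prop)]
    simp_rw [integral_const_mul, integral_pow_mul_conj_pow_unitCircleMeasure]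
    have hww : w ^ i * (starRingEnd ℂ w) ^ i = 1 := by
      rw [← mul_pow, Complex.mul_conj', hw]; simp
    simp only [mul_ite, mul_one, mul_zero, Finset.sum_ite_eq, hi, if_true]
    rw [mul_assoc, hww, mul_one, Complex.mul_conj']
  rw [integral_complex_ofReal] at key
  exact_mod_cast key

theorem integral_log_norm_one_sub_mul_conj_pow {c : ℂ} (hc : ‖c‖ < 1) (k : ℕ) :
    ∫ z, (Real.log ‖1 - c * z‖ : ℂ) * (starRingEnd ℂ z) ^ k ∂unitCircleMeasure =
      -(c ^ k / (2 * k)) := by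
  have hnorm : ∀ᵐ z ∂unitCircleMeasure, ‖c * z‖ < 1 := by
    filter_upwards [ae_norm_eq_one_unitCircleMeasure] with z hz
    simpa [hz] using hc
  have hsum : Summable fun n : ℕ => ‖c‖ ^ n := summable_geometric_of_lt_one (norm_nonneg _) hc
  set F : ℕ → ℂ → ℂ := fun n z => -((c * z) ^ n / n + starRingEnd ℂ ((c * z) ^ n / n)) / 2 *
    (starRingEnd ℂ z) ^ k with hF
  have hFc : ∀ n, Continuous (F n) := fun n => by
    simp only [hF, div_eq_mul_inv]
    fun_prop
  have hFint : ∀ n, ∫ z, F n z ∂unitCircleMeasure =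
      if n = k then -(c ^ k / (2 * k)) else 0 := by
    intro n
    have h1 : ∀ z, F n z = (-(c ^ n / (2 * n))) * (z ^ n * (starRingEnd ℂ z) ^ k) +
        (-((starRingEnd ℂ c) ^ n / (2 * n))) * (z ^ 0 * (starRingEnd ℂ z) ^ (n + k)) := by
      intro z
      simp only [hF, map_div₀, map_pow, map_mul, map_natCast]
      ring
    simp_rw [h1]
    rw [integral_add (Continuous.integrable_unitCircleMeasure (by fun_prop))
      (Continuous.integrable_unitCircleMeasure (by fun_prop)), integral_const_mul,
      integral_const_mul, integral_pow_mul_conj_pow_unitCircleMeasure,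
      integral_pow_mul_conj_pow_unitCircleMeasure]
    rcases Nat.eq_zero_or_pos n with rfl | hn
    · by_cases hk : 0 = k
      · subst hk; simp
      · simp [hk]
    · have : ¬ (0 = n + k) := by omega
      by_cases hk : n = k
      · subst hk; simp [this]
      · simp [hk, this]
  have hae : ∀ᵐ z ∂unitCircleMeasure, ∑' n, F n z =
      (Real.log ‖1 - c * z‖ : ℂ) * (starRingEnd ℂ z) ^ k := by
    filter_upwards [hnorm] with z hz
    have h1 := Complex.hasSum_taylorSeries_neg_log hz
    have h2 : HasSum (fun n : ℕ => starRingEnd ℂ ((c * z) ^ n / n))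
        (starRingEnd ℂ (-Complex.log (1 - c * z))) := by
      simpa [Function.comp_def] using h1.map (starRingEnd ℂ) Complex.continuous_conj
    have h3 := (((h1.add h2).neg.div_const 2).mul_right ((starRingEnd ℂ z) ^ k))
    rw [show (∑' n, F n z) = _ from h3.tsum_eq, Complex.add_conj, Complex.neg_re,
      Complex.log_re]
    push_cast
    ring
  rw [← integral_congr_ae hae]
  have hb : ∀ n, ∀ᵐ z ∂unitCircleMeasure, ‖F n z‖ ≤ ‖c‖ ^ n := by
    intro n
    filter_upwards [ae_norm_eq_one_unitCircleMeasure] with z hz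
    have h1 : ‖(c * z) ^ n / n‖ ≤ ‖c‖ ^ n := by
      rw [norm_div, norm_pow, norm_mul, hz, mul_one, Complex.norm_natCast]
      rcases Nat.eq_zero_or_pos n with rfl | hn
      · simp
      · exact div_le_self (by positivity) (by exact_mod_cast hn)
    simp only [hF, norm_mul, norm_pow, RCLike.norm_conj, hz, one_pow, mul_one, norm_div, norm_neg,
      Complex.norm_ofNat]
    have := norm_add_le ((c * z) ^ n / n) (starRingEnd ℂ ((c * z) ^ n / n))
    rw [RCLike.norm_conj] at this
    linarith
  have hs := hasSum_integral_of_summable_integral_norm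
    (fun n => (hFc n).integrable_unitCircleMeasure) (hsum.of_nonneg_of_le
      (fun n => integral_nonneg fun _ => norm_nonneg _) fun n => by
        simpa using integral_mono_ae (hFc n).integrable_unitCircleMeasure.norm
          (integrable_const _) (hb n))
  rw [← hs.tsum_eq]
  simp_rw [hFint]
  simp

theorem norm_sum_pow_le_of_prod_norm_sub_le {ι : Type*} [Fintype ι] {w : ι → ℂ}
    (hw : ∀ i, ‖w i‖ = 1) {B : ℝ} (hB : ∀ z : ℂ, ‖z‖ = 1 → ∏ i, ‖z - w i‖ ≤ Real.exp B)
    {k : ℕ} (hk : k ≠ 0) : ‖∑ i, w i ^ k‖ ≤ 2 * k * B := by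
  have hdisc : ∀ z : ℂ, ‖z‖ ≤ 1 → ∏ i, ‖z - w i‖ ≤ Real.exp B := by
    intro z hz
    have := Complex.norm_le_of_forall_mem_frontier_norm_le (f := fun z => ∏ i, (z - w i))
      (U := Metric.ball 0 1) (C := Real.exp B) (z := z) Metric.isBounded_ball
      (Differentiable.diffContOnCl (by fun_prop))
      (fun z hz => by
        rw [frontier_ball _ one_ne_zero] at hz
        rw [norm_prod]
        exact hB z (by simpa using hz))
      (by rw [closure_ball _ one_ne_zero]; simpa using hz)
    rwa [norm_prod] at this
  have hr : ∀ r ∈ Set.Ioo (0 : ℝ) 1, r ^ k * ‖∑ i, w i ^ k‖ ≤ 2 * k * B := by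
    rintro r ⟨hr0, hr1⟩
    set c : ι → ℂ := fun i => r * starRingEnd ℂ (w i) with hc
    have hcn : ∀ i, ‖c i‖ = r := fun i => by simp [hc, hw, abs_of_pos hr0]
    have hne : ∀ i, ∀ z : ℂ, ‖z‖ = 1 → 1 - c i * z ≠ 0 := by
      intro i z hz h
      have : ‖c i * z‖ = 1 := by rw [← sub_eq_zero.1 h, norm_one]
      rw [norm_mul, hcn, hz] at this
      linarith
    have hint : ∀ i, Integrable (fun z => Real.log ‖1 - c i * z‖) unitCircleMeasure := by
      intro i
      refine ContinuousOn.integrable_unitCircleMeasure (ContinuousOn.log (by fun_prop) ?_)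
        (Real.measurable_log.comp (by fun_prop)).aestronglyMeasurable
      intro z hz
      exact norm_ne_zero_iff.2 (hne i z (by simpa using hz))
    have hcint : ∀ j i, Integrable (fun z => (Real.log ‖1 - c i * z‖ : ℂ) *
        (starRingEnd ℂ z) ^ j) unitCircleMeasure := by
      intro j i
      refine (hint i).ofReal.mul_bdd (c := 1) (by fun_prop) ?_
      filter_upwards [ae_norm_eq_one_unitCircleMeasure] with z hz
      simp [hz]
    set V : ℂ → ℝ := fun z => B - ∑ i, Real.log ‖1 - c i * z‖ with hV
    have hVint : Integrable V unitCircleMeasure :=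
      (integrable_const _).sub (integrable_finsetSum _ fun i _ => hint i)
    have hV0 : ∀ᵐ z ∂unitCircleMeasure, 0 ≤ V z := by
      filter_upwards [ae_norm_eq_one_unitCircleMeasure] with z hz
      have h1 := hdisc (r * z) (by simp [hz, abs_of_pos hr0, hr1.le])
      have h2 : ∏ i, ‖r * z - w i‖ = ∏ i, ‖1 - c i * z‖ := by
        refine Finset.prod_congr rfl fun i _ => ?_
        have : r * z - w i = -(w i) * (1 - c i * z) := by
          have : w i * starRingEnd ℂ (w i) = 1 := by rw [Complex.mul_conj', hw]; simp
          linear_combination (-(r * z)) * this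
        rw [this, norm_mul, norm_neg, hw, one_mul]
      rw [hV]
      simp only
      rw [sub_nonneg, ← Real.log_prod fun i _ => norm_ne_zero_iff.2 (hne i z hz), ← h2]
      refine (Real.log_le_log ?_ h1).trans_eq (Real.log_exp B)
      rw [h2]
      exact Finset.prod_pos fun i _ => norm_pos_iff.2 (hne i z hz)
    have hlog := fun i => integral_log_norm_one_sub_mul_conj_pow ((hcn i).trans_lt hr1)
    have hmoment : ∀ j : ℕ, ∫ z, (V z : ℂ) * (starRingEnd ℂ z) ^ j ∂unitCircleMeasure =
        B * (if j = 0 then 1 else 0) + ∑ i, c i ^ j / (2 * j) := by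
      intro j
      have h1 : ∀ z, (V z : ℂ) * (starRingEnd ℂ z) ^ j = B * (z ^ 0 * (starRingEnd ℂ z) ^ j) -
          ∑ i, (Real.log ‖1 - c i * z‖ : ℂ) * (starRingEnd ℂ z) ^ j := by
        intro z
        rw [hV, ← Finset.sum_mul]
        push_cast
        ring
      simp_rw [h1]
      rw [integral_sub (Continuous.integrable_unitCircleMeasure (by fun_prop))
        (integrable_finsetSum _ fun i _ => hcint j i), integral_finsetSum _ fun i _ => hcint j i,
        integral_const_mul, integral_pow_mul_conj_pow_unitCircleMeasure]
      simp_rw [hlog]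
      simp [eq_comm]
    have hVB : ∫ z, V z ∂unitCircleMeasure = B := by
      have := hmoment 0
      simp only [pow_zero, mul_one, integral_complex_ofReal] at this
      exact_mod_cast (by simpa using this)
    have h3 : ‖∫ z, (V z : ℂ) * (starRingEnd ℂ z) ^ k ∂unitCircleMeasure‖ ≤ B := by
      refine (norm_integral_le_of_norm_le hVint ?_).trans_eq hVB
      filter_upwards [hV0, ae_norm_eq_one_unitCircleMeasure] with z hz hz1
      simp [hz1, abs_of_nonneg hz]
    rw [hmoment, if_neg hk, mul_zero, zero_add, ← Finset.sum_div, norm_div] at h3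
    have h4 : ‖∑ i, c i ^ k‖ = r ^ k * ‖∑ i, w i ^ k‖ := by
      simp only [hc, mul_pow]
      rw [← Finset.mul_sum, norm_mul, ← RCLike.norm_conj (∑ i, w i ^ k), map_sum]
      simp [abs_of_pos hr0]
    rw [h4] at h3
    have h5 : ‖(2 * k : ℂ)‖ = 2 * k := by simp
    rw [h5, div_le_iff₀ (by positivity)] at h3
    linarith
  have hlim : Filter.Tendsto (fun r : ℝ => r ^ k * ‖∑ i, w i ^ k‖) (nhdsWithin 1 (Set.Iio 1))
      (nhds (1 ^ k * ‖∑ i, w i ^ k‖)) :=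
    (Continuous.tendsto (by fun_prop) 1).mono_left nhdsWithin_le_nhds
  rw [one_pow, one_mul] at hlim
  refine le_of_tendsto hlim ?_
  filter_upwards [Ioo_mem_nhdsLT (zero_lt_one' ℝ)] with r h using hr r h

theorem integral_norm_sub_sq_mul_norm_sum_sq_unitCircleMeasure {n : ℕ} {a : ℕ → ℝ}
    (h0 : a 0 = 0) (hn : a n = 0) {w : ℂ} (hw : ‖w‖ = 1) :
    ∫ z, ‖z - w‖ ^ 2 * ‖∑ j ∈ Finset.range n, (a j : ℂ) * (z * starRingEnd ℂ w) ^ j‖ ^ 2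
        ∂unitCircleMeasure = ∑ j ∈ Finset.range n, (a (j + 1) - a j) ^ 2 := by
  have hw' : ‖starRingEnd ℂ w‖ = 1 := by simpa using hw
  have h1 : ∀ x : ℂ, (x - 1) * ∑ j ∈ Finset.range n, (a j : ℂ) * x ^ j =
      -x * ∑ j ∈ Finset.range n, ((a (j + 1) - a j : ℝ) : ℂ) * x ^ j := by
    intro x
    have h2 := Finset.sum_range_succ' (fun j => (a j : ℂ) * x ^ j) n
    rw [Finset.sum_range_succ] at h2
    simp only [h0, hn, Complex.ofReal_zero, zero_mul, add_zero] at h2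
    have h3 : x * ∑ j ∈ Finset.range n, ((a (j + 1) - a j : ℝ) : ℂ) * x ^ j =
        ∑ j ∈ Finset.range n, (a (j + 1) : ℂ) * x ^ (j + 1) -
          x * ∑ j ∈ Finset.range n, (a j : ℂ) * x ^ j := by
      rw [Finset.mul_sum, Finset.mul_sum, ← Finset.sum_sub_distrib]
      refine Finset.sum_congr rfl fun j _ => ?_
      push_cast
      ring
    rw [neg_mul, h3, ← h2]
    ring
  have h2 : ∀ᵐ z ∂unitCircleMeasure,
      ‖z - w‖ ^ 2 * ‖∑ j ∈ Finset.range n, (a j : ℂ) * (z * starRingEnd ℂ w) ^ j‖ ^ 2 =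
      ‖∑ j ∈ Finset.range n, ((a (j + 1) - a j : ℝ) : ℂ) * (z * starRingEnd ℂ w) ^ j‖ ^ 2 := by
    filter_upwards [ae_norm_eq_one_unitCircleMeasure] with z hz
    have h3 : ‖z - w‖ = ‖z * starRingEnd ℂ w - 1‖ := by
      rw [← mul_one ‖z - w‖, ← hw', ← norm_mul, sub_mul, Complex.mul_conj', hw]
      simp
    rw [h3, ← mul_pow, ← norm_mul, h1, norm_mul, norm_neg, norm_mul, hz, hw', one_mul, one_mul]
  rw [integral_congr_ae h2, integral_norm_sum_sq_unitCircleMeasure _ _ hw']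
  simp only [Complex.norm_real, Real.norm_eq_abs, sq_abs]

theorem abs_mul_sub_integral_mul_norm_sum_sq_le {n : ℕ} {a : ℕ → ℝ}
    (h0 : a 0 = 0) (hn : a n = 0) {w : ℂ} (hw : ‖w‖ = 1) {f : ℂ → ℝ} (hf : Continuous f)
    (hlip : ∀ x y, |f x - f y| ≤ ‖x - y‖) {δ : ℝ} (hδ : 0 < δ) :
    |(∑ j ∈ Finset.range n, a j ^ 2) * f w -
      ∫ z, f z * ‖∑ j ∈ Finset.range n, (a j : ℂ) * (z * starRingEnd ℂ w) ^ j‖ ^ 2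
        ∂unitCircleMeasure| ≤
      δ / 2 * (∑ j ∈ Finset.range n, a j ^ 2) +
        1 / (2 * δ) * ∑ j ∈ Finset.range n, (a (j + 1) - a j) ^ 2 := by
  have hw' : ‖starRingEnd ℂ w‖ = 1 := by simpa using hw
  set K : ℂ → ℝ := fun z => ‖∑ j ∈ Finset.range n, (a j : ℂ) * (z * starRingEnd ℂ w) ^ j‖ ^ 2
    with hK
  have hKc : Continuous K := by fun_prop
  have hK0 : ∀ z, 0 ≤ K z := fun z => by positivity
  have hK1 : ∫ z, K z ∂unitCircleMeasure = ∑ j ∈ Finset.range n, a j ^ 2 := by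
    rw [hK, integral_norm_sum_sq_unitCircleMeasure _ _ hw']
    simp
  have hK2 := integral_norm_sub_sq_mul_norm_sum_sq_unitCircleMeasure h0 hn hw
  rw [← hK1, ← hK2, ← integral_const_mul, ← integral_const_mul, ← integral_mul_const,
    ← integral_sub (Continuous.integrable_unitCircleMeasure (by fun_prop))
      (Continuous.integrable_unitCircleMeasure (by fun_prop)),
    ← integral_add (Continuous.integrable_unitCircleMeasure (by fun_prop))
      (Continuous.integrable_unitCircleMeasure (by fun_prop))]
  refine (abs_integral_le_integral_abs).trans (integral_mono
    (Continuous.integrable_unitCircleMeasure (by fun_prop))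
    (Continuous.integrable_unitCircleMeasure (by fun_prop)) fun z => ?_)
  have h1 : K z * f w - f z * K z = (f w - f z) * K z := by ring
  have h2 : ‖z - w‖ ≤ δ / 2 + 1 / (2 * δ) * ‖z - w‖ ^ 2 := by
    have : 0 ≤ (‖z - w‖ - δ) ^ 2 / (2 * δ) := by positivity
    have h3 : (‖z - w‖ - δ) ^ 2 / (2 * δ) =
        δ / 2 + 1 / (2 * δ) * ‖z - w‖ ^ 2 - ‖z - w‖ := by
      field_simp
      ring
    linarith
  have h3 := (hlip w z).trans_eq (norm_sub_rev w z)
  calc |K z * f w - f z * K z| = |f w - f z| * K z := by rw [h1, abs_mul, abs_of_nonneg (hK0 z)]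
    _ ≤ (δ / 2 + 1 / (2 * δ) * ‖z - w‖ ^ 2) * K z :=
      mul_le_mul_of_nonneg_right (h3.trans h2) (hK0 z)
    _ = δ / 2 * K z + 1 / (2 * δ) * (‖z - w‖ ^ 2 * K z) := by ring

theorem norm_sum_conj_pow_mul_pow_le {ι : Type*} [Fintype ι] {w : ι → ℂ}
    (hw : ∀ i, ‖w i‖ = 1) {B : ℝ} (hpow : ∀ k : ℕ, k ≠ 0 → ‖∑ i, w i ^ k‖ ≤ 2 * k * B)
    {n : ℕ} (hB : 0 ≤ B) {i j : ℕ} (hi : i < n) (hj : j < n) :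
    ‖∑ l, starRingEnd ℂ (w l) ^ i * w l ^ j - if i = j then (Fintype.card ι : ℂ) else 0‖ ≤
      2 * n * B := by
  have hww : ∀ l (m : ℕ), starRingEnd ℂ (w l) ^ m * w l ^ m = 1 := fun l m => by
    rw [← mul_pow, Complex.conj_mul', hw]; simp
  have hn : ∀ k : ℕ, k ≠ 0 → k < n → ‖∑ i, w i ^ k‖ ≤ 2 * n * B := by
    intro k hk hkn
    refine (hpow k hk).trans ?_
    have : (k : ℝ) ≤ n := by exact_mod_cast hkn.le
    gcongr
  rcases lt_trichotomy i j with h | h | h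
  · obtain ⟨d, rfl⟩ := Nat.exists_eq_add_of_lt h
    rw [if_neg (by omega), sub_zero]
    have : ∀ l, starRingEnd ℂ (w l) ^ i * w l ^ (i + d + 1) = w l ^ (d + 1) := fun l => by
      rw [add_assoc, pow_add _ i, ← mul_assoc, hww, one_mul]
    simp_rw [this]
    exact hn _ (by omega) (by omega)
  · subst h
    simp only [hww, if_true]
    simp only [Finset.sum_const, Finset.card_univ, nsmul_eq_mul, mul_one, sub_self, norm_zero]
    positivity
  · obtain ⟨d, rfl⟩ := Nat.exists_eq_add_of_lt h
    rw [if_neg (by omega), sub_zero]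
    have : ∀ l, starRingEnd ℂ (w l) ^ (j + d + 1) * w l ^ j = starRingEnd ℂ (w l ^ (d + 1)) :=
      fun l => by
      rw [add_assoc, pow_add _ j, mul_right_comm, hww, one_mul, map_pow]
    simp_rw [this]
    rw [← map_sum, RCLike.norm_conj]
    exact hn _ (by omega) (by omega)

theorem abs_sum_norm_sum_sq_sub_le {ι : Type*} [Fintype ι] {w : ι → ℂ}
    (hw : ∀ i, ‖w i‖ = 1) {B : ℝ} (hpow : ∀ k : ℕ, k ≠ 0 → ‖∑ i, w i ^ k‖ ≤ 2 * k * B)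
    {n : ℕ} (hB : 0 ≤ B) {a : ℕ → ℝ} (ha : ∀ j < n, 0 ≤ a j) {z : ℂ} (hz : ‖z‖ = 1) :
    |∑ l, ‖∑ j ∈ Finset.range n, (a j : ℂ) * (z * starRingEnd ℂ (w l)) ^ j‖ ^ 2 -
      Fintype.card ι * ∑ j ∈ Finset.range n, a j ^ 2| ≤
      2 * n * B * (∑ j ∈ Finset.range n, a j) ^ 2 := by
  rw [← Real.norm_eq_abs, ← Complex.norm_real, sq (∑ j ∈ Finset.range n, a j), Finset.sum_mul_sum]
  have hzz : ∀ m : ℕ, z ^ m * starRingEnd ℂ z ^ m = 1 := fun m => by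
    rw [← mul_pow, Complex.mul_conj', hz]; simp
  have h1 : ((∑ l, ‖∑ j ∈ Finset.range n, (a j : ℂ) * (z * starRingEnd ℂ (w l)) ^ j‖ ^ 2 -
      Fintype.card ι * ∑ j ∈ Finset.range n, a j ^ 2 : ℝ) : ℂ) =
      ∑ i ∈ Finset.range n, ∑ j ∈ Finset.range n, ((a i * a j : ℝ) : ℂ) *
        (z ^ i * starRingEnd ℂ z ^ j) * (∑ l, starRingEnd ℂ (w l) ^ i * w l ^ j -
          if i = j then (Fintype.card ι : ℂ) else 0) := by
    simp only [mul_sub, Finset.sum_sub_distrib]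
    push_cast
    congr 1
    · simp_rw [Finset.mul_sum]
      have h2 : ∀ i ∈ Finset.range n, ∑ j ∈ Finset.range n, ∑ l, ((a i : ℂ) * a j) *
          (z ^ i * starRingEnd ℂ z ^ j) * (starRingEnd ℂ (w l) ^ i * w l ^ j) =
          ∑ l, ∑ j ∈ Finset.range n, ((a i : ℂ) * a j) *
          (z ^ i * starRingEnd ℂ z ^ j) * (starRingEnd ℂ (w l) ^ i * w l ^ j) :=
        fun i _ => Finset.sum_comm
      rw [Finset.sum_congr rfl h2, Finset.sum_comm]
      refine Finset.sum_congr rfl fun l _ => ?_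
      rw [← Complex.mul_conj', map_sum, Finset.sum_mul_sum]
      refine Finset.sum_congr rfl fun i _ => Finset.sum_congr rfl fun j _ => ?_
      simp only [map_mul, map_pow, Complex.conj_ofReal, Complex.conj_conj]
      ring
    · rw [Finset.mul_sum]
      refine Finset.sum_congr rfl fun i hi => ?_
      simp only [mul_ite, mul_zero, Finset.sum_ite_eq, hi, if_true, hzz]
      ring
  rw [h1, Finset.mul_sum]
  refine norm_sum_le_of_le _ fun i hi => ?_
  rw [Finset.mul_sum]
  refine norm_sum_le_of_le _ fun j hj => ?_
  have hai := ha i (Finset.mem_range.1 hi)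
  have haj := ha j (Finset.mem_range.1 hj)
  rw [norm_mul, norm_mul, norm_mul, norm_pow, norm_pow, RCLike.norm_conj, hz, one_pow, one_pow,
    mul_one, mul_one, Complex.norm_real, Real.norm_of_nonneg (mul_nonneg hai haj), mul_comm]
  exact mul_le_mul_of_nonneg_right (norm_sum_conj_pow_mul_pow_le hw hpow hB
    (Finset.mem_range.1 hi) (Finset.mem_range.1 hj)) (mul_nonneg hai haj)

theorem sum_range_mul_sub (x : ℝ) (n : ℕ) :
    ∑ j ∈ Finset.range n, (j : ℝ) * (x - j) = n * (n - 1) * (3 * x - 2 * n + 1) / 6 := by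
  induction n with
  | zero => simp
  | succ n ih => rw [Finset.sum_range_succ, ih]; push_cast; ring

theorem abs_sum_sub_card_mul_integral_le {ι : Type*} [Fintype ι] {w : ι → ℂ}
    (hw : ∀ i, ‖w i‖ = 1) {B : ℝ} (hpow : ∀ k : ℕ, k ≠ 0 → ‖∑ i, w i ^ k‖ ≤ 2 * k * B)
    {n : ℕ} (hn : 3 ≤ n) (hB : 0 ≤ B) {f : ℂ → ℝ} (hf : Continuous f)
    (hlip : ∀ x y, |f x - f y| ≤ ‖x - y‖) (hf1 : ∀ x, |f x| ≤ 1) :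
    |∑ i, f (w i) - Fintype.card ι * ∫ z, f z ∂unitCircleMeasure| ≤
      Fintype.card ι * (7 / n) + 2 * n ^ 2 * B := by
  have hn' : (3 : ℝ) ≤ n := by exact_mod_cast hn
  have hn0 : (0 : ℝ) < n := by linarith
  set a : ℕ → ℝ := fun j => j * (n - j) with ha
  set A := ∑ j ∈ Finset.range n, a j ^ 2 with hA
  have ha0 : ∀ j < n, 0 ≤ a j := fun j hj => by
    have : (j : ℝ) ≤ n := by exact_mod_cast hj.le
    exact mul_nonneg (by positivity) (by linarith)
  have hS : ∑ j ∈ Finset.range n, a j = n * (n ^ 2 - 1) / 6 := by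
    rw [ha, sum_range_mul_sub]; ring
  have hSA : (∑ j ∈ Finset.range n, a j) ^ 2 ≤ n * A := by
    simpa using sq_sum_le_card_mul_sum_sq (s := Finset.range n) (f := a)
  have hM : ∑ j ∈ Finset.range n, (a (j + 1) - a j) ^ 2 ≤ n ^ 3 := by
    have : ∀ j ∈ Finset.range n, (a (j + 1) - a j) ^ 2 ≤ (n : ℝ) ^ 2 := by
      intro j hj
      have hj' : (j : ℝ) + 1 ≤ n := by exact_mod_cast Finset.mem_range.1 hj
      have hj0 : (0 : ℝ) ≤ j := by positivity
      rw [sq_le_sq, abs_of_pos hn0, abs_le]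
      constructor <;> simp only [ha] <;> push_cast <;> nlinarith
    calc _ ≤ ∑ j ∈ Finset.range n, (n : ℝ) ^ 2 := Finset.sum_le_sum this
      _ = n ^ 3 := by simp; ring
  have hAlow : n ^ 5 ≤ 49 * A := by
    rw [hS] at hSA
    have h1 : (n : ℝ) * (6 / 7 * n ^ 2) / 6 ≤ n * (n ^ 2 - 1) / 6 := by
      have : 6 / 7 * (n : ℝ) ^ 2 ≤ n ^ 2 - 1 := by nlinarith
      gcongr
    have h2 := (pow_le_pow_left₀ (by positivity) h1 2).trans hSA
    have h3 : (n : ℝ) * (n ^ 5 / 49) ≤ n * A := by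
      refine le_trans (le_of_eq ?_) h2
      ring
    have := le_of_mul_le_mul_left h3 hn0
    linarith
  have hA0 : 0 < A := by
    have : (0 : ℝ) < n ^ 5 := by positivity
    linarith
  set K : ι → ℂ → ℝ := fun i z =>
    ‖∑ j ∈ Finset.range n, (a j : ℂ) * (z * starRingEnd ℂ (w i)) ^ j‖ ^ 2 with hK
  have h1 : ∀ i, |A * f (w i) - ∫ z, f z * K i z ∂unitCircleMeasure| ≤ A * (7 / n) := by
    intro i
    refine (abs_mul_sub_integral_mul_norm_sum_sq_le (n := n) (a := a) (by simp [ha])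
      (by simp [ha]) (hw i) hf hlip (δ := 7 / n) (by positivity)).trans ?_
    have h2 : 1 / (2 * (7 / (n : ℝ))) * ∑ j ∈ Finset.range n, (a (j + 1) - a j) ^ 2 ≤
        7 / n / 2 * A := by
      calc _ ≤ 1 / (2 * (7 / (n : ℝ))) * n ^ 3 := by gcongr
        _ = 7 / n / 2 * (n ^ 5 / 49) := by field_simp; norm_num
        _ ≤ 7 / n / 2 * A := by gcongr; linarith
    linarith
  have hint : ∀ i, Integrable (fun z => f z * K i z) unitCircleMeasure :=
    fun i => Continuous.integrable_unitCircleMeasure (by fun_prop)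
  have h2 : |∑ i, ∫ z, f z * K i z ∂unitCircleMeasure -
      Fintype.card ι * A * ∫ z, f z ∂unitCircleMeasure| ≤ A * (2 * n ^ 2 * B) := by
    rw [← integral_finsetSum _ fun i _ => hint i, ← integral_const_mul, ← integral_sub
      (integrable_finsetSum _ fun i _ => hint i)
      (Continuous.integrable_unitCircleMeasure (by fun_prop)), ← Real.norm_eq_abs]
    refine (norm_integral_le_of_norm_le_const ?_).trans_eq (by rw [probReal_univ, mul_one])
    filter_upwards [ae_norm_eq_one_unitCircleMeasure] with z hz
    have h3 := abs_sum_norm_sum_sq_sub_le hw hpow hB ha0 hz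
    rw [← Finset.mul_sum, mul_comm _ (f z), ← mul_sub, norm_mul]
    calc _ ≤ 1 * (2 * n * B * (∑ j ∈ Finset.range n, a j) ^ 2) :=
          mul_le_mul (hf1 z) h3 (abs_nonneg _) zero_le_one
      _ ≤ 1 * (2 * n * B * (n * A)) := by gcongr
      _ = A * (2 * n ^ 2 * B) := by ring
  have h3 : |∑ i, (A * f (w i) - ∫ z, f z * K i z ∂unitCircleMeasure)| ≤
      Fintype.card ι * (A * (7 / n)) := by
    refine (Finset.abs_sum_le_sum_abs _ _).trans ((Finset.sum_le_sum fun i _ => h1 i).trans_eq ?_)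
    simp
  have h4 : A * |∑ i, f (w i) - Fintype.card ι * ∫ z, f z ∂unitCircleMeasure| ≤
      A * (Fintype.card ι * (7 / n) + 2 * n ^ 2 * B) := by
    rw [← abs_of_pos hA0, ← abs_mul, abs_of_pos hA0]
    have h5 : A * (∑ i, f (w i) - Fintype.card ι * ∫ z, f z ∂unitCircleMeasure) =
        ∑ i, (A * f (w i) - ∫ z, f z * K i z ∂unitCircleMeasure) +
        (∑ i, ∫ z, f z * K i z ∂unitCircleMeasure -
          Fintype.card ι * A * ∫ z, f z ∂unitCircleMeasure) := by
      rw [Finset.sum_sub_distrib, ← Finset.mul_sum]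
      ring
    rw [h5]
    refine (abs_add_le _ _).trans ((add_le_add h3 h2).trans_eq ?_)
    ring
  exact le_of_mul_le_mul_left h4 hA0

theorem norm_coeff_zero_eq_mul_prod_norm {ι : Type*} [Fintype ι] {P : Polynomial ℂ} {z : ι → ℂ}
    (hz : Finset.univ.val.map z = P.roots) :
    ‖P.coeff 0‖ = ‖P.leadingCoeff‖ * ∏ i, ‖z i‖ := by
  rw [(IsAlgClosed.splits P).coeff_zero_eq_leadingCoeff_mul_prod_roots, ← hz]
  simp

theorem norm_eval_eq_mul_prod_norm_sub {ι : Type*} [Fintype ι] {P : Polynomial ℂ} {z : ι → ℂ}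
    (hz : Finset.univ.val.map z = P.roots) (x : ℂ) :
    ‖P.eval x‖ = ‖P.leadingCoeff‖ * ∏ i, ‖x - z i‖ := by
  rw [(IsAlgClosed.splits P).eval_eq_prod_roots, ← hz]
  simp

theorem log_coeffRatio {P : Polynomial ℂ} (h0 : P.coeff 0 ≠ 0) :
    Real.log (coeffRatio P) = Real.log (∑ i ∈ Finset.range (P.natDegree + 1), ‖P.coeff i‖) -
      (Real.log ‖P.coeff 0‖ + Real.log ‖P.leadingCoeff‖) / 2 := by
  have hP : P ≠ 0 := by rintro rfl; simp at h0
  have h1 := norm_pos_iff.2 h0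
  have h2 := norm_pos_iff.2 (Polynomial.leadingCoeff_ne_zero.2 hP)
  have h3 : 0 < ∑ i ∈ Finset.range (P.natDegree + 1), ‖P.coeff i‖ :=
    Finset.sum_pos' (fun _ _ => norm_nonneg _) ⟨0, by simp, h1⟩
  rw [coeffRatio, Polynomial.coeff_natDegree, Real.log_div h3.ne' (by positivity),
    Real.log_sqrt (by positivity), Real.log_mul h1.ne' h2.ne']

theorem sum_abs_log_norm_roots_le {ι : Type*} [Fintype ι] {P : Polynomial ℂ} {z : ι → ℂ}
    (hz : Finset.univ.val.map z = P.roots) (h0 : P.coeff 0 ≠ 0) (hz0 : ∀ i, z i ≠ 0) :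
    ∑ i, |Real.log ‖z i‖| ≤ 2 * Real.log (coeffRatio P) := by
  have hP : P ≠ 0 := by rintro rfl; simp at h0
  have h2 := norm_pos_iff.2 (Polynomial.leadingCoeff_ne_zero.2 hP)
  have hlog : Real.log ‖P.coeff 0‖ = Real.log ‖P.leadingCoeff‖ + ∑ i, Real.log ‖z i‖ := by
    rw [norm_coeff_zero_eq_mul_prod_norm hz, Real.log_mul h2.ne'
      (Finset.prod_ne_zero_iff.2 fun i _ => norm_ne_zero_iff.2 (hz0 i)),
      Real.log_prod fun i _ => norm_ne_zero_iff.2 (hz0 i)]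
  have hM : Real.log ‖P.leadingCoeff‖ + ∑ i, Real.posLog ‖z i‖ ≤
      Real.log (∑ i ∈ Finset.range (P.natDegree + 1), ‖P.coeff i‖) := by
    have h3 := P.logMahlerMeasure_eq_log_leadingCoeff_add_sum_log_roots
    rw [P.logMahlerMeasure_eq_log_MahlerMeasure, ← hz, Multiset.map_map] at h3
    refine (h3.symm.trans_le (Real.log_le_log (P.mahlerMeasure_pos_of_ne_zero hP)
      P.mahlerMeasure_le_sum_norm_coeff)).trans_eq ?_
    rw [Polynomial.sum_over_range _ fun _ => norm_zero]
  have habs : ∀ x : ℝ, |Real.log x| = 2 * Real.posLog x - Real.log x := by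
    intro x
    rw [Real.posLog]
    rcases le_total 0 (Real.log x) with h | h
    · rw [abs_of_nonneg h, max_eq_right h]; ring
    · rw [abs_of_nonpos h, max_eq_left h]; ring
  simp_rw [habs]
  rw [Finset.sum_sub_distrib, ← Finset.mul_sum, log_coeffRatio h0]
  linarith

theorem norm_sub_div_norm_sq_mul_norm_le {x z : ℂ} (hx : ‖x‖ = 1) (hz : z ≠ 0) :
    ‖x - z / ‖z‖‖ ^ 2 * ‖z‖ ≤ ‖x - z‖ ^ 2 := by
  have hr := norm_pos_iff.2 hz
  have hr' : (‖z‖ : ℂ) ≠ 0 := Complex.ofReal_ne_zero.2 hr.ne'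
  have hw : ‖z / (‖z‖ : ℂ)‖ = 1 := by simp [hz]
  have hre : (x * starRingEnd ℂ z).re = ‖z‖ * (x * starRingEnd ℂ (z / ‖z‖)).re := by
    rw [← Complex.re_ofReal_mul, map_div₀, Complex.conj_ofReal]
    congr 1
    field_simp
  have hsub : ∀ u v : ℂ, ‖u - v‖ ^ 2 = ‖u‖ ^ 2 + ‖v‖ ^ 2 - 2 * (u * starRingEnd ℂ v).re := by
    intro u v
    simp only [Complex.sq_norm, Complex.normSq_sub]
  rw [hsub, hsub, hw, hx, hre]
  nlinarith [sq_nonneg (1 - ‖z‖)]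

theorem prod_norm_sub_div_norm_le_coeffRatio {ι : Type*} [Fintype ι] {P : Polynomial ℂ}
    {z : ι → ℂ} (hz : Finset.univ.val.map z = P.roots) (h0 : P.coeff 0 ≠ 0)
    (hz0 : ∀ i, z i ≠ 0) {x : ℂ} (hx : ‖x‖ = 1) :
    ∏ i, ‖x - z i / ‖z i‖‖ ≤ coeffRatio P := by
  have hP : P ≠ 0 := by rintro rfl; simp at h0
  have h1 := norm_pos_iff.2 h0
  have h2 := norm_pos_iff.2 (Polynomial.leadingCoeff_ne_zero.2 hP)
  set D := Real.sqrt (‖P.coeff 0‖ * ‖P.leadingCoeff‖) with hD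
  have hD0 : 0 < D := by positivity
  have hprod : (∏ i, ‖x - z i / ‖z i‖‖) ^ 2 * ∏ i, ‖z i‖ ≤ (∏ i, ‖x - z i‖) ^ 2 := by
    rw [← Finset.prod_pow, ← Finset.prod_pow, ← Finset.prod_mul_distrib]
    exact Finset.prod_le_prod (fun i _ => by positivity) fun i _ =>
      norm_sub_div_norm_sq_mul_norm_le hx (hz0 i)
  have heval : ‖P.eval x‖ ≤ ∑ i ∈ Finset.range (P.natDegree + 1), ‖P.coeff i‖ := by
    rw [Polynomial.eval_eq_sum_range]
    refine norm_sum_le_of_le _ fun i _ => ?_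
    simp [hx]
  rw [coeffRatio, Polynomial.coeff_natDegree, ← hD, le_div_iff₀ hD0]
  refine le_trans ?_ heval
  rw [← sq_le_sq₀ (by positivity) (norm_nonneg _), mul_pow, hD, Real.sq_sqrt (by positivity),
    norm_eval_eq_mul_prod_norm_sub hz, norm_coeff_zero_eq_mul_prod_norm hz, mul_pow]
  calc _ = ‖P.leadingCoeff‖ ^ 2 * ((∏ i, ‖x - z i / ‖z i‖‖) ^ 2 * ∏ i, ‖z i‖) := by ring
    _ ≤ _ := by gcongr

theorem two_le_coeffRatio {P : Polynomial ℂ} (h0 : P.coeff 0 ≠ 0) (hN : 1 ≤ P.natDegree) :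
    2 ≤ coeffRatio P := by
  have hP : P ≠ 0 := by rintro rfl; simp at h0
  have h1 := norm_pos_iff.2 h0
  have h2 := norm_pos_iff.2 (Polynomial.leadingCoeff_ne_zero.2 hP)
  have h3 : ‖P.coeff 0‖ + ‖P.leadingCoeff‖ ≤
      ∑ i ∈ Finset.range (P.natDegree + 1), ‖P.coeff i‖ := by
    rw [Finset.sum_range_succ, Polynomial.coeff_natDegree]
    gcongr
    exact Finset.single_le_sum (f := fun i => ‖P.coeff i‖) (fun _ _ => norm_nonneg _)
      (Finset.mem_range.2 hN)
  rw [coeffRatio, Polynomial.coeff_natDegree, le_div_iff₀ (by positivity)]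
  refine le_trans ?_ h3
  rw [← Real.sqrt_sq (by norm_num : (0 : ℝ) ≤ 2), ← Real.sqrt_mul (by positivity)]
  refine Real.sqrt_le_iff.2 ⟨by positivity, ?_⟩
  nlinarith [sq_nonneg (‖P.coeff 0‖ - ‖P.leadingCoeff‖)]

theorem integral_zeroMeasure {ι : Type*} [Fintype ι] {P : Polynomial ℂ} {z : ι → ℂ}
    (hz : Finset.univ.val.map z = P.roots) (f : ℂ → ℝ) :
    ∫ x, f x ∂zeroMeasure P = (P.natDegree : ℝ)⁻¹ * ∑ i, f (z i) := by
  have h1 : (P.roots.map fun z => Measure.dirac z).sum = ∑ i, Measure.dirac (z i) := by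
    rw [← hz, Multiset.map_map]; rfl
  rw [zeroMeasure, integral_smul_measure, h1,
    integral_finsetSum_measure fun i _ => integrable_dirac (by simp)]
  simp

theorem abs_sub_div_norm_le {f : ℂ → ℝ} (hlip : ∀ x y, |f x - f y| ≤ ‖x - y‖)
    (hf1 : ∀ x, |f x| ≤ 1) {z : ℂ} (hz : z ≠ 0) :
    |f z - f (z / ‖z‖)| ≤ 4 * |Real.log ‖z‖| := by
  have hr := norm_pos_iff.2 hz
  have h1 : ‖z - z / ‖z‖‖ = |‖z‖ - 1| := by
    have hr' : (‖z‖ : ℂ) ≠ 0 := Complex.ofReal_ne_zero.2 hr.ne'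
    have h2 : z - z / ‖z‖ = (z / ‖z‖) * ((‖z‖ - 1 : ℝ) : ℂ) := by
      push_cast
      field_simp
    rw [h2, norm_mul, Complex.norm_real]
    simp [hz]
  have h2 := (hlip z (z / ‖z‖)).trans_eq h1
  rcases le_total ‖z‖ 1 with h | h
  · rw [abs_of_nonpos (a := ‖z‖ - 1) (by linarith)] at h2
    have h3 := Real.log_le_sub_one_of_pos hr
    have h4 := abs_nonneg (Real.log ‖z‖)
    have h5 := neg_abs_le (Real.log ‖z‖)
    have h6 := neg_le_abs (Real.log ‖z‖)
    linarith
  · rw [abs_of_nonneg (a := ‖z‖ - 1) (by linarith)] at h2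
    have h3 := Real.one_sub_inv_le_log_of_pos hr
    have h6 := le_abs_self (Real.log ‖z‖)
    rcases le_total ‖z‖ 2 with h' | h'
    · have : (‖z‖ - 1) / 2 ≤ 1 - ‖z‖⁻¹ := by
        have h7 : 1 - ‖z‖⁻¹ - (‖z‖ - 1) / 2 = (‖z‖ - 1) * (2 - ‖z‖) / (2 * ‖z‖) := by
          field_simp
        have : 0 ≤ (‖z‖ - 1) * (2 - ‖z‖) / (2 * ‖z‖) :=
          div_nonneg (mul_nonneg (by linarith) (by linarith)) (by positivity)
        linarith
      linarith
    · have h7 := Real.log_le_log two_pos h'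
      have h8 := Real.log_two_gt_d9
      have h9 := abs_le.1 (hf1 z)
      have h10 := abs_le.1 (hf1 (z / ‖z‖))
      rw [abs_le]
      constructor <;> linarith

theorem abs_sub_le_norm_sub_of_blNorm_le_one {f : ℂ → ℝ} (hf : blNorm f ≤ 1) (x y : ℂ) :
    |f x - f y| ≤ ‖x - y‖ := by
  rcases eq_or_ne x y with rfl | hxy
  · simp
  have h1 : edist (f x) (f y) / edist x y ≤ lipSeminorm f := by
    rw [lipSeminorm]
    refine le_iSup_of_le x (le_iSup_of_le y ?_)
    exact le_iSup (fun _ : x ≠ y => edist (f x) (f y) / edist x y) hxy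
  replace h1 := (h1.trans (le_self_add : lipSeminorm f ≤ lipSeminorm f + supNorm f)).trans hf
  rw [ENNReal.div_le_iff (by simpa using hxy) (edist_ne_top _ _), one_mul, edist_dist, edist_dist,
    ENNReal.ofReal_le_ofReal_iff dist_nonneg] at h1
  rwa [← Real.dist_eq, ← dist_eq_norm]

theorem abs_le_one_of_blNorm_le_one {f : ℂ → ℝ} (hf : blNorm f ≤ 1) (x : ℂ) : |f x| ≤ 1 := by
  have h1 : ‖f x‖ₑ ≤ 1 :=
    ((le_iSup (fun z => ‖f z‖ₑ) x).trans
      (le_add_self : supNorm f ≤ lipSeminorm f + supNorm f)).trans hf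
  rw [← ofReal_norm, ENNReal.ofReal_le_one] at h1
  exact h1

theorem isProbabilityMeasure_zeroMeasure {P : Polynomial ℂ} (hN : 1 ≤ P.natDegree) :
    IsProbabilityMeasure (zeroMeasure P) := by
  refine ⟨?_⟩
  have h1 : ∀ s : Multiset ℂ, (s.map fun z => Measure.dirac z).sum Set.univ =
      (Multiset.card s : ℝ≥0∞) := by
    intro s
    induction s using Multiset.induction_on with
    | empty => simp
    | cons a s ih => simp [ih, add_comm]
  rw [zeroMeasure, Measure.smul_apply, h1,
    Polynomial.splits_iff_card_roots.1 (IsAlgClosed.splits P), smul_eq_mul]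
  exact ENNReal.inv_mul_cancel (by exact_mod_cast Nat.one_le_iff_ne_zero.1 hN)
    (ENNReal.natCast_ne_top _)

theorem abs_integral_zeroMeasure_sub_le {P : Polynomial ℂ} (hN : 1 ≤ P.natDegree)
    (h0 : P.coeff 0 ≠ 0) {f : ℂ → ℝ} (hlip : ∀ x y, |f x - f y| ≤ ‖x - y‖)
    (hf1 : ∀ x, |f x| ≤ 1) {n : ℕ} (hn : 3 ≤ n) :
    |∫ x, f x ∂zeroMeasure P - ∫ x, f x ∂unitCircleMeasure| ≤
      7 / n + (2 * n ^ 2 + 8) * (Real.log (coeffRatio P) / P.natDegree) := by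
  classical
  obtain ⟨ι, _, z, hz⟩ : ∃ (ι : Type) (_ : Fintype ι) (z : ι → ℂ),
      Finset.univ.val.map z = P.roots :=
    ⟨P.roots, inferInstance, fun x => x.1, Multiset.map_univ_coe _⟩
  have hcard : Fintype.card ι = P.natDegree := by
    rw [← Polynomial.splits_iff_card_roots.1 (IsAlgClosed.splits P), ← hz]
    simp
  have hz0 : ∀ i, z i ≠ 0 := by
    intro i hi
    have h1 := norm_coeff_zero_eq_mul_prod_norm hz
    rw [Finset.prod_eq_zero (Finset.mem_univ i) (by rw [hi, norm_zero]), mul_zero,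
      norm_eq_zero] at h1
    exact h0 h1
  have hN0 : (0 : ℝ) < P.natDegree := by exact_mod_cast hN
  have hL := two_le_coeffRatio h0 hN
  set B := Real.log (coeffRatio P) with hB
  have hB0 : 0 ≤ B := Real.log_nonneg (by linarith)
  set w : ι → ℂ := fun i => z i / ‖z i‖ with hw
  have hw1 : ∀ i, ‖w i‖ = 1 := fun i => by simp [hw, hz0]
  have hpow : ∀ k : ℕ, k ≠ 0 → ‖∑ i, w i ^ k‖ ≤ 2 * k * B := fun k hk =>
    norm_sum_pow_le_of_prod_norm_sub_le hw1 (fun x hx => by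
      rw [hB, Real.exp_log (by linarith)]
      exact prod_norm_sub_div_norm_le_coeffRatio hz h0 hz0 hx) hk
  have hf : Continuous f := by
    refine (LipschitzWith.of_dist_le_mul (K := 1) fun x y => ?_).continuous
    simpa [Real.dist_eq, dist_eq_norm] using hlip x y
  have h1 := abs_sum_sub_card_mul_integral_le hw1 hpow hn hB0 hf hlip hf1
  have h2 : |∑ i, (f (z i) - f (w i))| ≤ 8 * B := by
    calc _ ≤ ∑ i, 4 * |Real.log ‖z i‖| := (Finset.abs_sum_le_sum_abs _ _).trans
          (Finset.sum_le_sum fun i _ => abs_sub_div_norm_le hlip hf1 (hz0 i))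
      _ ≤ 8 * B := by
        rw [← Finset.mul_sum]
        linarith [sum_abs_log_norm_roots_le hz h0 hz0]
  rw [hcard] at h1
  rw [integral_zeroMeasure hz]
  have h3 : (P.natDegree : ℝ)⁻¹ * ∑ i, f (z i) - ∫ x, f x ∂unitCircleMeasure =
      (P.natDegree : ℝ)⁻¹ * (∑ i, (f (z i) - f (w i)) +
        (∑ i, f (w i) - P.natDegree * ∫ x, f x ∂unitCircleMeasure)) := by
    rw [Finset.sum_sub_distrib]
    field_simp
    ring
  rw [h3, abs_mul, abs_of_pos (inv_pos.2 hN0)]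
  calc _ ≤ (P.natDegree : ℝ)⁻¹ * (8 * B + (P.natDegree * (7 / n) + 2 * n ^ 2 * B)) := by
        gcongr
        exact (abs_add_le _ _).trans (add_le_add h2 h1)
    _ = _ := by
      field_simp
      ring

theorem proposition2p8 (P : Polynomial ℂ) (N : ℕ) (hN : 1 ≤ N) (hdeg : P.natDegree = N)
    (hP : P.coeff 0 * P.coeff N ≠ 0) :
    blDist (zeroMeasure P) unitCircleMeasure ≤
      ENNReal.ofReal (32 * (Real.log (coeffRatio P) / (N : ℝ)) ^ (1 / 4 : ℝ)) := by
  subst hdeg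
  have h0 : P.coeff 0 ≠ 0 := left_ne_zero_of_mul hP
  have hN0 : (0 : ℝ) < P.natDegree := by exact_mod_cast hN
  have hε : 0 < Real.log (coeffRatio P) / P.natDegree :=
    div_pos (Real.log_pos (by linarith [two_le_coeffRatio h0 hN])) hN0
  refine iSup₂_le fun f hf => ENNReal.ofReal_le_ofReal ?_
  have hlip := abs_sub_le_norm_sub_of_blNorm_le_one hf
  have hf1 := abs_le_one_of_blNorm_le_one hf
  have hmain := fun n (hn : 3 ≤ n) =>
    abs_integral_zeroMeasure_sub_le (n := n) hN h0 hlip hf1 hn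
  set ε := Real.log (coeffRatio P) / P.natDegree
  set x := ε ^ (1 / 4 : ℝ) with hx
  have hx0 : 0 < x := Real.rpow_pos_of_pos hε _
  have hx4 : x ^ 4 = ε := by
    rw [hx, ← Real.rpow_natCast, ← Real.rpow_mul hε.le]
    norm_num
  rcases le_total (1 / 16) x with h | h
  · have h1 : |∫ x, f x ∂zeroMeasure P| ≤ 1 := by
      have := isProbabilityMeasure_zeroMeasure hN
      simpa using norm_integral_le_of_norm_le_const (μ := zeroMeasure P) (f := f) (C := 1)
        (Filter.Eventually.of_forall hf1)
    have h2 : |∫ x, f x ∂unitCircleMeasure| ≤ 1 := by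
      simpa using norm_integral_le_of_norm_le_const (μ := unitCircleMeasure) (f := f) (C := 1)
        (Filter.Eventually.of_forall hf1)
    refine (abs_sub _ _).trans ?_
    linarith
  · have hxinv : 16 ≤ x⁻¹ := by
      rw [le_inv_comm₀ (by norm_num) hx0]
      linarith
    set n := ⌊x⁻¹⌋₊ with hn
    have h16 : 16 ≤ n := Nat.le_floor (by exact_mod_cast hxinv)
    have hn16 : (16 : ℝ) ≤ n := by exact_mod_cast h16
    have hle : (n : ℝ) ≤ x⁻¹ := Nat.floor_le (by positivity)
    have hlt : x⁻¹ < n + 1 := Nat.lt_floor_add_one _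
    have h1 : x * n ≤ 1 := by
      rw [le_inv_comm₀ (by positivity) hx0, ← one_div, le_div_iff₀ (by positivity)] at hle
      exact hle
    have h2 : 7 / (n : ℝ) ≤ 14 * x := by
      rw [inv_lt_iff_one_lt_mul₀ hx0] at hlt
      rw [div_le_iff₀ (by positivity)]
      nlinarith
    have h3 : (n : ℝ) ^ 2 * ε ≤ x := by
      rw [← hx4]
      calc (n : ℝ) ^ 2 * x ^ 4 = (x * n) ^ 2 * (x * x) := by ring
        _ ≤ 1 ^ 2 * (x * 1) := by gcongr; linarith
        _ = x := by ring
    have h4 : ε ≤ x := by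
      refine le_trans ?_ h3
      exact le_mul_of_one_le_left hε.le (by nlinarith)
    linarith [hmain n (by omega)]
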